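/- Let $d\ge 3$ and let $T$ be the homogeneous tree of valency $d$, i.e. a connected graph without cycles in which every vertex has exactly $d$ neighbours. An end of $T$ is an equivalence class of geodesic rays (infinite sequences of successive neighbouring vertices without backtracking), two rays being equivalent if their intersection is infinite. Fix a vertex $o$ and an end $\omega$ of $T$. Equip the group $\operatorname{Aut} T$ of automorphisms of $T$ with the topology of pointwise convergence on the (discrete) vertex set, and let $\operatorname{Aff} T\le \operatorname{Aut} T$ be the closed subgroup of automorphisms fixing $\omega$, with the subspace topology. For a vertex $v$ let $h(v)=d(v,c)-d(o,c)\in\mathbb Z$, where $c$ is the first common vertex of the geodesic rays from $v$ and from $o$ representing $\omega$, and let $\operatorname{Hor} T$ be the kernel of the homomorphism $\phi\colon\operatorname{Aff} T\to\mathbb Z$, $\phi(\alpha)=h(\alpha o)$. **Theorem.** Let $\Gamma$ be a closed subgroup of $\operatorname{Aff} T$. Then the locally compact group $\Gamma$ is unimodular (it has a Haar measure that is both left and right invariant) if and only if it is exceptional, that is, $\Gamma\subseteq\operatorname{Hor} T$ or there is an end $\xi\neq\omega$ of $T$ that is fixed by every element of $\Gamma$. -/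

import Mathlib

open SimpleGraph MeasureTheory

namespace HomTree

section Tree

variable {V : Type*} {T : SimpleGraph V}

/-! ### Distances in trees -/

lemma between_unique (hT : T.IsTree) {a b p p' : V} (h : T.dist a p + T.dist p b = T.dist a b)
    (h₁ : T.dist a p' = T.dist a p) (h₂ : T.dist p' b = T.dist p b) : p = p' := by
  obtain ⟨q₁, hq₁⟩ := hT.connected.exists_walk_length_eq_dist a p
  obtain ⟨q₂, hq₂⟩ := hT.connected.exists_walk_length_eq_dist p b
  obtain ⟨r₁, hr₁⟩ := hT.connected.exists_walk_length_eq_dist a p'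
  obtain ⟨r₂, hr₂⟩ := hT.connected.exists_walk_length_eq_dist p' b
  have hq : (q₁.append q₂).IsPath :=
    Walk.isPath_of_length_eq_dist _ (by rw [Walk.length_append]; omega)
  have hr : (r₁.append r₂).IsPath :=
    Walk.isPath_of_length_eq_dist _ (by rw [Walk.length_append]; omega)
  have e : q₁.append q₂ = r₁.append r₂ := (hT.existsUnique_path a b).unique hq hr
  have e' := congrArg (fun w => w.getVert (T.dist a p)) e
  simpa [Walk.getVert_append, hq₁, hr₁, h₁] using e'

/-! ### Geodesic rays and ends -/

/-- A geodesic ray: a singly infinite sequence of successive neighbours without backtracking. -/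
structure GeodesicRay (T : SimpleGraph V) where
  /-- the vertices of the ray -/
  vert : ℕ → V
  adj : ∀ n, T.Adj (vert n) (vert (n + 1))
  no_backtrack : ∀ n, vert n ≠ vert (n + 2)

/-- Two geodesic rays are equivalent if their intersection is infinite. -/
def GeodesicRay.Equivalent (x y : GeodesicRay T) : Prop :=
  (Set.range x.vert ∩ Set.range y.vert).Infinite

/-- The image of a geodesic ray under an automorphism. -/
def GeodesicRay.map (α : T ≃g T) (x : GeodesicRay T) : GeodesicRay T where
  vert n := α (x.vert n)
  adj n := α.map_adj_iff.mpr (x.adj n)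
  no_backtrack n h := x.no_backtrack n (α.injective h)

/-- The ray obtained by deleting the first vertex. -/
def GeodesicRay.tail (x : GeodesicRay T) : GeodesicRay T where
  vert n := x.vert (n + 1)
  adj n := x.adj (n + 1)
  no_backtrack n := x.no_backtrack (n + 1)

/-- The ray obtained by adding a new first vertex. -/
def GeodesicRay.cons (v : V) (x : GeodesicRay T) (h : T.Adj v (x.vert 0)) (h' : v ≠ x.vert 1) :
    GeodesicRay T where
  vert n := Nat.casesOn n v x.vert
  adj n := by cases n with
    | zero => exact h
    | succ n => exact x.adj n
  no_backtrack n := by cases n with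
    | zero => exact h'
    | succ n => exact x.no_backtrack n

lemma GeodesicRay.dist_aux (hT : T.IsTree) (x : GeodesicRay T) (i k : ℕ) :
    T.dist (x.vert i) (x.vert (i + k)) = k ∧
      T.dist (x.vert i) (x.vert (i + (k + 1))) = k + 1 := by
  induction k with
  | zero => exact ⟨by simp, by simpa using dist_eq_one_iff_adj.mpr (x.adj i)⟩
  | succ k ih =>
    refine ⟨ih.2, ?_⟩
    rcases hT.dist_eq_dist_add_one_of_adj (x.vert i) (x.adj (i + (k + 1))) with h | h
    · exfalso
      refine x.no_backtrack (i + k) (between_unique (a := x.vert i)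
        (b := x.vert (i + (k + 1))) hT ?_ ?_ ?_)
      · rw [ih.1, ih.2, show i + (k + 1) = i + k + 1 from rfl,
          dist_eq_one_iff_adj.mpr (x.adj (i + k))]
      · rw [ih.1]
        have : i + (k + 1) + 1 = i + k + 2 := by ring
        rw [this, ih.2] at h
        omega
      · rw [show i + (k + 1) = i + k + 1 from rfl,
          dist_eq_one_iff_adj.mpr (x.adj (i + k)), dist_comm]
        exact dist_eq_one_iff_adj.mpr (x.adj (i + k + 1))
    · have : i + (k + 1 + 1) = i + (k + 1) + 1 := by ring
      rw [this, h, ih.2]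

lemma GeodesicRay.dist_vert (hT : T.IsTree) (x : GeodesicRay T) {i j : ℕ} (h : i ≤ j) :
    T.dist (x.vert i) (x.vert j) = j - i := by
  obtain ⟨k, rfl⟩ := Nat.exists_eq_add_of_le h
  rw [(x.dist_aux hT i k).1]
  omega

lemma GeodesicRay.injective (hT : T.IsTree) (x : GeodesicRay T) :
    Function.Injective x.vert := by
  have key : ∀ {i j : ℕ}, i ≤ j → x.vert i = x.vert j → i = j := by
    intro i j h e
    have := x.dist_vert hT h
    rw [e, dist_self] at this
    omega
  intro i j e
  rcases le_total i j with h | h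
  · exact key h e
  · exact (key h e.symm).symm

lemma GeodesicRay.Equivalent.eq_add (hT : T.IsTree) {x y : GeodesicRay T} (h : x.Equivalent y)
    {m n : ℕ} (e : x.vert m = y.vert n) (k : ℕ) : x.vert (m + k) = y.vert (n + k) := by
  obtain ⟨w, ⟨⟨m', hm'⟩, n', hn'⟩, hw⟩ := (h.sdiff
    (((Set.finite_Iio (m + k)).image x.vert).union
      ((Set.finite_Iio (n + k)).image y.vert))).nonempty
  have hm : m + k ≤ m' := by
    by_contra! hc
    exact hw (Or.inl ⟨m', hc, hm'⟩)
  have hn : n + k ≤ n' := by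
    by_contra! hc
    exact hw (Or.inr ⟨n', hc, hn'⟩)
  have d₁ := x.dist_vert hT (show m ≤ m' by omega)
  have d₂ := y.dist_vert hT (show n ≤ n' by omega)
  rw [hm', e] at d₁
  rw [hn', d₁] at d₂
  refine between_unique (a := x.vert m) (b := w) hT ?_ ?_ ?_
  · rw [x.dist_vert hT (by omega), ← hm', x.dist_vert hT hm, x.dist_vert hT (by omega)]
    omega
  · rw [x.dist_vert hT (by omega), e, y.dist_vert hT (by omega)]
    omega
  · nth_rw 1 [← hn']
    rw [← hm', x.dist_vert hT hm, y.dist_vert hT hn]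
    omega

lemma GeodesicRay.equivalent_of_eq_add (hT : T.IsTree) {x y : GeodesicRay T} {m n : ℕ}
    (h : ∀ k, x.vert (m + k) = y.vert (n + k)) : x.Equivalent y := by
  refine Set.infinite_of_injective_forall_mem (f := fun k => x.vert (m + k)) ?_ ?_
  · intro a b e
    have := x.injective hT e
    omega
  · exact fun k => ⟨⟨_, rfl⟩, n + k, (h k).symm⟩

lemma GeodesicRay.Equivalent.exists_eq {x y : GeodesicRay T} (h : x.Equivalent y) (K : ℕ) :
    ∃ m n, K ≤ m ∧ x.vert m = y.vert n := by
  obtain ⟨w, ⟨⟨m', hm'⟩, n', hn'⟩, hw⟩ := (h.sdiff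
    ((Set.finite_Iio K).image x.vert)).nonempty
  refine ⟨m', n', ?_, by rw [hm', hn']⟩
  by_contra! hc
  exact hw ⟨m', hc, hm'⟩

lemma GeodesicRay.equivalent_equivalence (hT : T.IsTree) :
    Equivalence (GeodesicRay.Equivalent (T := T)) where
  refl x := x.equivalent_of_eq_add hT (m := 0) (n := 0) fun _ => rfl
  symm := fun {x y} h => by
    unfold GeodesicRay.Equivalent at h ⊢
    rwa [Set.inter_comm]
  trans := fun {x y z} h₁ h₂ => by
    obtain ⟨m, n, -, e⟩ := h₁.exists_eq 0
    obtain ⟨n', l, hn, e'⟩ := h₂.exists_eq n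
    obtain ⟨j, rfl⟩ := Nat.exists_eq_add_of_le hn
    refine x.equivalent_of_eq_add hT (m := m + j) (n := l) fun k => ?_
    rw [← h₂.eq_add hT e' k, add_assoc, add_assoc, h₁.eq_add hT e]

/-- Equivalence of geodesic rays in a tree, as a setoid. -/
def raySetoid (hT : T.IsTree) : Setoid (GeodesicRay T) :=
  ⟨GeodesicRay.Equivalent, GeodesicRay.equivalent_equivalence hT⟩

/-- The space `∂T` of ends of the tree `T`: equivalence classes of geodesic rays. -/
def TreeEnd (hT : T.IsTree) : Type _ := Quotient (raySetoid hT)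

/-- The end represented by a geodesic ray. -/
def GeodesicRay.toEnd (hT : T.IsTree) (x : GeodesicRay T) : TreeEnd hT :=
  Quotient.mk (raySetoid hT) x

lemma GeodesicRay.toEnd_eq (hT : T.IsTree) {x y : GeodesicRay T} :
    x.toEnd hT = y.toEnd hT ↔ x.Equivalent y :=
  @Quotient.eq _ (raySetoid hT) x y

lemma GeodesicRay.Equivalent.map (α : T ≃g T) {x y : GeodesicRay T} (h : x.Equivalent y) :
    (x.map α).Equivalent (y.map α) := by
  refine (Set.Infinite.image (f := α) α.injective.injOn h).mono ?_
  rintro _ ⟨w, ⟨⟨m, hm⟩, n, hn⟩, rfl⟩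
  exact ⟨⟨m, congrArg α hm⟩, n, congrArg α hn⟩

/-- The action of the automorphism group `Aut T` on the ends of `T`. -/
instance endAction (hT : T.IsTree) : MulAction (T ≃g T) (TreeEnd hT) where
  smul α := Quotient.map (sa := raySetoid hT) (sb := raySetoid hT) (GeodesicRay.map α)
    fun _ _ h => GeodesicRay.Equivalent.map α h
  one_smul ξ := Quotient.inductionOn (s := raySetoid hT) ξ fun _ => rfl
  mul_smul _ _ ξ := Quotient.inductionOn (s := raySetoid hT) ξ fun _ => rfl

lemma smul_toEnd (hT : T.IsTree) (α : T ≃g T) (x : GeodesicRay T) :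
    α • x.toEnd hT = (x.map α).toEnd hT := rfl

/-! ### The topology of `Aut T` -/

/-- The topology of pointwise convergence on `Aut T`, where the vertex set is discrete. -/
instance autTopology (T : SimpleGraph V) : TopologicalSpace (T ≃g T) :=
  TopologicalSpace.induced (fun (α : T ≃g T) (v : V) => α v)
    (@Pi.topologicalSpace V (fun _ => V) fun _ => ⊥)

/-- A set of automorphisms is open if and only if it is a union of sets
`{β | α v = β v for all v in F}`, with `F` a finite set of vertices. -/
lemma isOpen_aut_iff {S : Set (T ≃g T)} :
    IsOpen S ↔ ∀ α ∈ S, ∃ F : Finset V, {β : T ≃g T | ∀ v ∈ F, α v = β v} ⊆ S := by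
  let _ : TopologicalSpace V := ⊥
  have : DiscreteTopology V := ⟨rfl⟩
  rw [isOpen_iff_mem_nhds]
  refine forall₂_congr fun α _ => ?_
  have hn : nhds α = (nhds (fun v => α v)).comap (fun (β : T ≃g T) (v : V) => β v) :=
    nhds_induced _ _
  rw [hn, Filter.mem_comap]
  constructor
  · rintro ⟨U, hU, hS⟩
    rw [nhds_pi, Filter.mem_pi] at hU
    obtain ⟨I, hI, t, ht, hU⟩ := hU
    refine ⟨hI.toFinset, fun β hβ => hS (hU fun v hv => ?_)⟩
    have := hβ v (hI.mem_toFinset.mpr hv)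
    simpa [← this] using mem_of_mem_nhds (ht v)
  · rintro ⟨F, hF⟩
    refine ⟨(F : Set V).pi fun v => {α v}, ?_, fun β hβ => hF fun v hv => (hβ v hv).symm⟩
    exact set_pi_mem_nhds F.finite_toSet fun v _ => by simp

/-! ### The affine group, the Busemann function and the horocyclic group -/

/-- The affine group `Aff T`: all automorphisms of `T` that fix the distinguished end `ω`.
It carries the subspace topology. -/
abbrev Aff (hT : T.IsTree) (ω : TreeEnd hT) : Subgroup (T ≃g T) :=
  MulAction.stabilizer (T ≃g T) ω

lemma exists_ray (hT : T.IsTree) (v : V) (ξ : TreeEnd hT) :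
    ∃ x : GeodesicRay T, x.vert 0 = v ∧ x.toEnd hT = ξ := by
  obtain ⟨y, hy⟩ : ∃ y : GeodesicRay T, y.toEnd hT = ξ := Quotient.exists_rep ξ
  obtain ⟨p⟩ := hT.connected.preconnected v (y.vert 0)
  suffices H : ∀ (u w : V) (_ : T.Walk u w), (∃ x : GeodesicRay T, x.vert 0 = w ∧
      x.toEnd hT = ξ) → ∃ x : GeodesicRay T, x.vert 0 = u ∧ x.toEnd hT = ξ from
    H _ _ p ⟨y, rfl, hy⟩
  intro u w q h
  induction q with
  | nil => exact h
  | @cons a b c hab q ih =>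
    obtain ⟨x, hx, hx'⟩ := ih h
    by_cases ha : a = x.vert 1
    · refine ⟨x.tail, ha.symm, ?_⟩
      rw [← hx', GeodesicRay.toEnd_eq]
      exact x.tail.equivalent_of_eq_add hT (m := 0) (n := 1) fun k =>
        congrArg x.vert (by omega)
    · refine ⟨x.cons a (hx ▸ hab) ha, rfl, ?_⟩
      rw [← hx', GeodesicRay.toEnd_eq]
      refine GeodesicRay.equivalent_of_eq_add hT (m := 1) (n := 0) fun k => ?_
      rw [Nat.add_comm 1 k, Nat.zero_add]
      rfl

/-- The unique geodesic ray that starts at `v` and represents the end `ξ`. -/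
noncomputable def rayTo (hT : T.IsTree) (v : V) (ξ : TreeEnd hT) : GeodesicRay T :=
  (exists_ray hT v ξ).choose

lemma rayTo_zero (hT : T.IsTree) (v : V) (ξ : TreeEnd hT) : (rayTo hT v ξ).vert 0 = v :=
  (exists_ray hT v ξ).choose_spec.1

lemma rayTo_toEnd (hT : T.IsTree) (v : V) (ξ : TreeEnd hT) : (rayTo hT v ξ).toEnd hT = ξ :=
  (exists_ray hT v ξ).choose_spec.2

lemma vert_rayTo (hT : T.IsTree) (x : GeodesicRay T) (k : ℕ) :
    (rayTo hT (x.vert 0) (x.toEnd hT)).vert k = x.vert k := by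
  have h := ((GeodesicRay.toEnd_eq hT).mp (rayTo_toEnd hT (x.vert 0) (x.toEnd hT))).eq_add hT
    (rayTo_zero hT (x.vert 0) (x.toEnd hT)) k
  simpa using h

/-- The first vertex of the ray from `v` to `ω` that also lies on the ray from `o` to `ω`. -/
noncomputable def firstCommon (hT : T.IsTree) (ω : TreeEnd hT) (o v : V) : V :=
  (rayTo hT v ω).vert
    (sInf {i : ℕ | (rayTo hT v ω).vert i ∈ Set.range (rayTo hT o ω).vert})

/-- The Busemann function `h(v) = d(v, c) - d(o, c)`, where `c` is the first common vertex of the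
geodesic rays from `v` and from `o` to the end `ω`. -/
noncomputable def busemann (hT : T.IsTree) (ω : TreeEnd hT) (o v : V) : ℤ :=
  (T.dist v (firstCommon hT ω o v) : ℤ) - (T.dist o (firstCommon hT ω o v) : ℤ)

lemma busemann_eq (hT : T.IsTree) (ω : TreeEnd hT) {o v : V} {m n : ℕ}
    (e : (rayTo hT v ω).vert m = (rayTo hT o ω).vert n) : busemann hT ω o v = m - n := by
  have hne : {i : ℕ | (rayTo hT v ω).vert i ∈ Set.range (rayTo hT o ω).vert}.Nonempty :=
    ⟨m, n, e.symm⟩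
  have hle := Nat.sInf_le (show m ∈ {i : ℕ | (rayTo hT v ω).vert i ∈
    Set.range (rayTo hT o ω).vert} from ⟨n, e.symm⟩)
  obtain ⟨j, hj⟩ := Nat.sInf_mem hne
  unfold busemann firstCommon
  set i := sInf {i : ℕ | (rayTo hT v ω).vert i ∈ Set.range (rayTo hT o ω).vert}
  obtain ⟨k, rfl⟩ := Nat.exists_eq_add_of_le hle
  have heq : (rayTo hT v ω).Equivalent (rayTo hT o ω) := by
    rw [← GeodesicRay.toEnd_eq hT, rayTo_toEnd, rayTo_toEnd]
  have hn := (rayTo hT o ω).injective hT (e.symm.trans (heq.eq_add hT hj.symm k))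
  have d₁ := (rayTo hT v ω).dist_vert hT (Nat.zero_le i)
  have d₂ := (rayTo hT o ω).dist_vert hT (Nat.zero_le j)
  rw [rayTo_zero, Nat.sub_zero] at d₁ d₂
  rw [hj] at d₂
  rw [d₁, d₂]
  subst hn
  push_cast
  ring

lemma rayTo_equivalent (hT : T.IsTree) (ω : TreeEnd hT) (u v : V) :
    (rayTo hT u ω).Equivalent (rayTo hT v ω) := by
  rw [← GeodesicRay.toEnd_eq hT, rayTo_toEnd, rayTo_toEnd]

lemma busemann_add (hT : T.IsTree) (ω : TreeEnd hT) (o u v : V) :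
    busemann hT ω o v = busemann hT ω o u + busemann hT ω u v := by
  obtain ⟨m, n, -, e⟩ := (rayTo_equivalent hT ω v u).exists_eq 0
  obtain ⟨n', l, hn, e'⟩ := (rayTo_equivalent hT ω u o).exists_eq n
  obtain ⟨j, rfl⟩ := Nat.exists_eq_add_of_le hn
  have e₁ := (rayTo_equivalent hT ω v u).eq_add hT e j
  rw [busemann_eq hT ω (e₁.trans e'), busemann_eq hT ω e', busemann_eq hT ω e₁]
  ring

lemma busemann_smul (hT : T.IsTree) (ω : TreeEnd hT) (α : Aff hT ω) (o v : V) :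
    busemann hT ω ((α : T ≃g T) o) ((α : T ≃g T) v) = busemann hT ω o v := by
  have key : ∀ (u : V) (k : ℕ), (rayTo hT ((α : T ≃g T) u) ω).vert k =
      (α : T ≃g T) ((rayTo hT u ω).vert k) := by
    intro u k
    have h := vert_rayTo hT ((rayTo hT u ω).map (α : T ≃g T)) k
    have h0 : ((rayTo hT u ω).map (α : T ≃g T)).vert 0 = (α : T ≃g T) u :=
      congrArg (α : T ≃g T) (rayTo_zero hT u ω)
    have h1 : ((rayTo hT u ω).map (α : T ≃g T)).toEnd hT = ω := by
      rw [← smul_toEnd, rayTo_toEnd]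
      exact α.2
    rw [h0, h1] at h
    exact h
  obtain ⟨m, n, -, e⟩ := (rayTo_equivalent hT ω v o).exists_eq 0
  rw [busemann_eq hT ω e]
  exact busemann_eq hT ω (by rw [key, key, e])

/-- The horocyclic map `φ(α) = h(α o)`, a homomorphism from `Aff T` to the integers. -/
noncomputable def horocyclic (hT : T.IsTree) (ω : TreeEnd hT) (o : V) :
    Aff hT ω →* Multiplicative ℤ where
  toFun α := Multiplicative.ofAdd (busemann hT ω o ((α : T ≃g T) o))
  map_one' := by
    have : busemann hT ω o o = 0 := by
      rw [busemann_eq hT ω (m := 0) (n := 0) rfl]; simp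
    simp [this]
  map_mul' α β := by
    rw [← ofAdd_add]
    congr 1
    rw [busemann_add hT ω o ((α : T ≃g T) o), ← busemann_smul hT ω α o ((β : T ≃g T) o)]
    rfl

/-- The horocyclic group `Hor T`, the kernel of the horocyclic map. -/
noncomputable def Hor (hT : T.IsTree) (ω : TreeEnd hT) (o : V) : Subgroup (Aff hT ω) :=
  (horocyclic hT ω o).ker

/-- A horocyclic automorphism preserves every horocycle `{v | h(v) = m}`. -/
lemma mem_Hor_iff (hT : T.IsTree) (ω : TreeEnd hT) (o : V) (α : Aff hT ω) :
    α ∈ Hor hT ω o ↔ ∀ v, busemann hT ω o ((α : T ≃g T) v) = busemann hT ω o v := by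
  have h0 : busemann hT ω o o = 0 := by
    rw [busemann_eq hT ω (m := 0) (n := 0) rfl]; simp
  have h : α ∈ Hor hT ω o ↔ busemann hT ω o ((α : T ≃g T) o) = 0 := by
    rw [Hor, MonoidHom.mem_ker]
    exact ofAdd_eq_one
  rw [h]
  constructor
  · intro h v
    rw [busemann_add hT ω o ((α : T ≃g T) o), busemann_smul, h, zero_add]
  · intro h
    rw [h o, h0]

/-- A subgroup of `Aff T` is exceptional if it is contained in `Hor T` or if there is an end, apart
from `ω`, which is fixed by each of its elements. -/
def IsExceptional (hT : T.IsTree) (ω : TreeEnd hT) (o : V) (Γ : Subgroup (Aff hT ω)) : Prop :=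
  Γ ≤ Hor hT ω o ∨ ∃ ξ : TreeEnd hT, ξ ≠ ω ∧ ∀ γ ∈ Γ, (γ : T ≃g T) • ξ = ξ

end Tree

/-- A group with a topology is unimodular if it has a Haar measure (a nonzero left invariant
measure, here a Borel measure that is finite on compact sets and positive on nonempty open sets)
that is also right invariant. -/
def IsUnimodular (G : Type*) [Group G] [TopologicalSpace G] : Prop :=
  letI : MeasurableSpace G := borel G
  ∃ μ : Measure G, μ.IsHaarMeasure ∧ μ.IsMulRightInvariant

end HomTree

namespace HomTree

open Filter Topology

/-! ### Unimodularity and conjugation of compact open subsets -/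

section Unimodular

variable {G : Type*} [Group G] [TopologicalSpace G] [IsTopologicalGroup G]

/-! Vertex stabilizers `Γ_v` are compact open subgroups of `Γ`, so a Haar measure detects any
failure of right invariance on them. If `Γ ⊆ Hor`, each element fixes a vertex far out towards `ω`,
hence lies in some `Γ_v`, and translating `Γ_v` by it on either side changes nothing. If `Γ` fixes
`ξ ≠ ω`, a vertex `v` on the line from `ξ` to `ω` has `Γ_v = Γ ∩ Hor`, a kernel and so normal.
Conversely, let `γ ∈ Γ` shift a ray `x` towards `ω`, and let `K` be the stabilizer of `x 0`.
Elements of `K` fix all of `x`, so `K ⊆ γ^i K γ^(-i)`; by unimodularity the measures agree and the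
inclusion is an equality (`IsUnimodular.eq_of_subset_conj`). Every horocyclic element is conjugated
into `K` by a power of `γ`, so it lies in `K` and fixes the whole axis of `γ`, including its other
end (`exists_fixed_end_of_isUnimodular`). As `φ(Γ) ≤ ℤ` is cyclic, `Γ` is generated by `Γ ∩ Hor` and
one such `γ`, unless `φ(Γ)` is trivial. -/

lemma isUnimodular_of_forall_exists_mul_mem_iff
    (h : ∀ g : G, ∃ K : Set G, IsOpen K ∧ IsCompact K ∧ K.Nonempty ∧
      ∀ x, x * g ∈ K ↔ g * x ∈ K) : IsUnimodular G := by
  borelize G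
  obtain ⟨K₀, hK₀, hK₀c, ⟨k, hk⟩, -⟩ := h 1
  have : LocallyCompactSpace G :=
    hK₀c.locallyCompactSpace_of_mem_nhds_of_group (hK₀.mem_nhds hk)
  let μ : Measure G := Measure.haar
  refine ⟨μ, inferInstance, ⟨fun g => ?_⟩⟩
  -- The right translate of `μ` is again left invariant, so it is a multiple of `μ`; comparing both
  -- on `K`, of positive finite measure, shows the factor is 1.
  have : (μ.map (· * g)).Regular := Measure.Regular.map (Homeomorph.mulRight g)
  have e := Measure.isMulLeftInvariant_eq_smul_of_regular (μ.map (· * g)) μ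
  obtain ⟨K, hK, hKc, hne, hKg⟩ := h g
  have hKμ : μ.map (· * g) K = μ K := by
    rw [Measure.map_apply (measurable_mul_const g) hK.measurableSet,
      show (· * g) ⁻¹' K = (g * ·) ⁻¹' K from Set.ext hKg, measure_preimage_mul]
  have hc : ((Measure.haarScalarFactor (μ.map (· * g)) μ : NNReal) : ENNReal) = 1 := by
    rw [e, Measure.smul_apply, ENNReal.smul_def, smul_eq_mul] at hKμ
    exact (ENNReal.mul_eq_right (hK.measure_pos μ hne).ne' hKc.measure_lt_top.ne).mp hKμ
  rw [e, ENNReal.coe_eq_one.mp hc, one_smul]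

/-- The sets `K ⊆ g K g⁻¹` have equal finite measure, so their difference is null; being open, it is
empty. -/
lemma IsUnimodular.eq_of_subset_conj (h : IsUnimodular G) {K : Set G} (hK : IsClopen K)
    (hKc : IsCompact K) (g : G) (hsub : ∀ x ∈ K, g⁻¹ * x * g ∈ K) {x : G}
    (hx : g⁻¹ * x * g ∈ K) : x ∈ K := by
  borelize G
  obtain ⟨μ, hμ, hμ'⟩ := h
  by_contra hxK
  let L : Set G := (fun x => g⁻¹ * x * g) ⁻¹' K
  have hcont : Continuous fun x : G => g⁻¹ * x * g := by fun_prop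
  have hL : IsClopen L := hK.preimage hcont
  have hLK : μ L = μ K := by
    rw [← measure_preimage_mul_right μ g K, ← measure_preimage_mul μ g⁻¹ ((· * g) ⁻¹' K)]
    rfl
  have hKL : K ⊆ L := hsub
  have hz : μ (L \ K) = 0 := by
    rw [measure_sdiff hKL hK.isOpen.measurableSet.nullMeasurableSet hKc.measure_lt_top.ne, hLK,
      tsub_self]
  exact ((hL.isOpen.sdiff hK.isClosed).measure_pos μ ⟨x, hx, hxK⟩).ne' hz

end Unimodular

section Tree

variable {V : Type*} {T : SimpleGraph V}

/-! ### The topological group `Aut T` -/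

lemma tendsto_aut_iff {X : Type*} {l : Filter X} {f : X → (T ≃g T)} {α : T ≃g T} :
    Tendsto f l (𝓝 α) ↔ ∀ v, ∀ᶠ x in l, f x v = α v := by
  let _ : TopologicalSpace V := ⊥
  have : DiscreteTopology V := ⟨rfl⟩
  have hi : IsInducing fun (α : T ≃g T) (v : V) => α v := ⟨rfl⟩
  simp only [hi.tendsto_nhds_iff, tendsto_pi_nhds, nhds_discrete, tendsto_pure,
    Function.comp_apply]

instance aut_isTopologicalGroup : IsTopologicalGroup (T ≃g T) where
  continuous_mul := continuous_iff_continuousAt.mpr fun ⟨α, β⟩ => tendsto_aut_iff.mpr fun v => by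
    have h₁ := tendsto_aut_iff.mp (continuous_fst.tendsto (α, β)) (β v)
    have h₂ := tendsto_aut_iff.mp (continuous_snd.tendsto (α, β)) v
    filter_upwards [h₁, h₂] with p hp hp'
    rw [RelIso.mul_apply, RelIso.mul_apply, hp', hp]
  continuous_inv := continuous_iff_continuousAt.mpr fun α => tendsto_aut_iff.mpr fun v => by
    filter_upwards [tendsto_aut_iff.mp (tendsto_id (x := 𝓝 α)) (α⁻¹ v)] with β hβ
    apply β.injective
    rw [RelIso.apply_inv_self, ← id_eq β, hβ, RelIso.apply_inv_self]

lemma isClopen_setOf_apply_eq (u v : V) : IsClopen {α : T ≃g T | α u = v} := by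
  constructor
  · rw [← isOpen_compl_iff, isOpen_aut_iff]
    exact fun α hα => ⟨{u}, fun β hβ h => hα ((hβ u (by simp)).trans h)⟩
  · rw [isOpen_aut_iff]
    exact fun α hα => ⟨{u}, fun β hβ => (hβ u (by simp)).symm.trans hα⟩

/-- Along a path from `v` to `w`, each next image is a neighbour of the previous one, so it has
finitely many candidates and the ultrafilter selects one. -/
lemma exists_eventually_apply_eq [T.LocallyFinite] (hT : T.Connected) {X : Type*}
    (l : Ultrafilter X) (f : X → (T ≃g T)) {v u : V} (h : ∀ᶠ x in l, f x v = u) (w : V) :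
    ∃ u', ∀ᶠ x in l, f x w = u' := by
  obtain ⟨p⟩ := hT.preconnected v w
  induction p generalizing u with
  | nil => exact ⟨u, h⟩
  | @cons a b c hab p ih =>
    have hfin : (T.neighborSet u).Finite := Set.toFinite _
    obtain ⟨u', -, hu'⟩ := (l.eventually_exists_mem_iff hfin (P := fun u' x => f x b = u')).mp (by
      filter_upwards [h] with x hx
      exact ⟨f x b, by rw [mem_neighborSet, ← hx]; exact (f x).map_adj_iff.mpr hab, rfl⟩)
    exact ih hu'

lemma isCompact_setOf_apply_eq_self [T.LocallyFinite] (hT : T.Connected) (v : V) :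
    IsCompact {α : T ≃g T | α v = v} := by
  rw [isCompact_iff_ultrafilter_le_nhds']
  intro l hl
  -- Limits of both `α` and `α⁻¹` are taken, so that the pointwise limit is invertible.
  have hl' : ∀ᶠ α : T ≃g T in l, α⁻¹ v = v := by
    filter_upwards [hl] with α hα
    exact α.injective (by rw [RelIso.apply_inv_self]; exact hα.symm)
  choose f hf using exists_eventually_apply_eq hT l id hl
  choose g hg using exists_eventually_apply_eq hT l (fun α => α⁻¹) hl'
  let α : T ≃g T :=
    { toFun := f
      invFun := g
      left_inv := fun w => by
        obtain ⟨β, h₁, h₂⟩ := ((hf w).and (hg (f w))).exists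
        rw [← h₂, ← h₁]
        exact RelIso.inv_apply_self _ _
      right_inv := fun w => by
        obtain ⟨β, h₁, h₂⟩ := ((hg w).and (hf (g w))).exists
        rw [← h₂, ← h₁]
        exact RelIso.apply_inv_self _ _
      map_rel_iff' := by
        intro a b
        obtain ⟨β, h₁, h₂⟩ := ((hf a).and (hf b)).exists
        change T.Adj (f a) (f b) ↔ _
        rw [← h₁, ← h₂]
        exact β.map_adj_iff }
  refine ⟨α, ?_, tendsto_id'.mp ?_⟩
  · obtain ⟨β, h₁, h₂⟩ := ((hf v).and hl).exists
    exact h₁.symm.trans h₂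
  · exact tendsto_aut_iff.mpr hf

/-! ### Fixed vertices of automorphisms that fix an end -/

lemma rayTo_map (hT : T.IsTree) {ξ : TreeEnd hT} {α : T ≃g T} (hα : α • ξ = ξ) (u : V) (k : ℕ) :
    (rayTo hT (α u) ξ).vert k = α ((rayTo hT u ξ).vert k) := by
  have h := vert_rayTo hT ((rayTo hT u ξ).map α) k
  have h0 : ((rayTo hT u ξ).map α).vert 0 = α u := congrArg α (rayTo_zero hT u ξ)
  have h1 : ((rayTo hT u ξ).map α).toEnd hT = ξ := by rw [← smul_toEnd, rayTo_toEnd, hα]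
  rwa [h0, h1] at h

lemma GeodesicRay.map_vert_eq (hT : T.IsTree) {x : GeodesicRay T} {α : T ≃g T}
    (hα : α • x.toEnd hT = x.toEnd hT) {i : ℕ} (hi : α (x.vert i) = x.vert i) (k : ℕ) :
    α (x.vert (i + k)) = x.vert (i + k) := by
  rw [smul_toEnd, GeodesicRay.toEnd_eq] at hα
  exact hα.eq_add hT (show (x.map α).vert i = x.vert i from hi) k

lemma smul_toEnd_eq_of_fixes (hT : T.IsTree) {x : GeodesicRay T} {α : T ≃g T} {i : ℕ}
    (h : ∀ k, α (x.vert (i + k)) = x.vert (i + k)) : α • x.toEnd hT = x.toEnd hT := by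
  rw [smul_toEnd, GeodesicRay.toEnd_eq]
  exact GeodesicRay.equivalent_of_eq_add hT (m := i) (n := i) h

lemma isCompact_setOf_aff_apply_eq_self [T.LocallyFinite] (hT : T.IsTree) (ω : TreeEnd hT)
    (v : V) : IsCompact {α : Aff hT ω | (α : T ≃g T) v = v} := by
  rw [Subtype.isCompact_iff]
  -- For an automorphism fixing `v`, fixing `ω` amounts to fixing each vertex of the ray from `v` to
  -- `ω`, a closed condition.
  have e : ((↑) : Aff hT ω → (T ≃g T)) '' {α : Aff hT ω | (α : T ≃g T) v = v} =
      {α : T ≃g T | α v = v} ∩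
        ⋂ k, {α : T ≃g T | α ((rayTo hT v ω).vert k) = (rayTo hT v ω).vert k} := by
    ext α
    simp only [Set.mem_image, Set.mem_ofPred_eq, Set.mem_inter_iff, Set.mem_iInter]
    constructor
    · rintro ⟨α, hα, rfl⟩
      refine ⟨hα, fun k => ?_⟩
      rw [← rayTo_map hT α.2, hα]
    · rintro ⟨hα, h⟩
      refine ⟨⟨α, ?_⟩, hα, rfl⟩
      have := smul_toEnd_eq_of_fixes hT (x := rayTo hT v ω) (i := 0) fun k => h (0 + k)
      rwa [rayTo_toEnd] at this
  rw [e]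
  exact (isCompact_setOf_apply_eq_self hT.connected v).inter_right
    (isClosed_iInter fun k => (isClopen_setOf_apply_eq _ _).isClosed)

lemma isCompact_stabilizer [T.LocallyFinite] (hT : T.IsTree) {ω : TreeEnd hT}
    {Γ : Subgroup (Aff hT ω)} (hΓ : IsClosed (Γ : Set (Aff hT ω))) (v : V) :
    IsCompact (MulAction.stabilizer Γ v : Set Γ) :=
  hΓ.isClosedEmbedding_subtypeVal.isCompact_preimage (isCompact_setOf_aff_apply_eq_self hT ω v)

lemma isClopen_stabilizer (hT : T.IsTree) {ω : TreeEnd hT} (Γ : Subgroup (Aff hT ω)) (v : V) :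
    IsClopen (MulAction.stabilizer Γ v : Set Γ) :=
  (isClopen_setOf_apply_eq v v).preimage (continuous_subtype_val.comp continuous_subtype_val)

/-- An automorphism that fixes `ω` acts on a ray towards `ω`, far out, as a shift. -/
lemma exists_shift (hT : T.IsTree) {ω : TreeEnd hT} (o : V) (α : Aff hT ω) :
    ∃ m n : ℕ, (m : ℤ) - n = busemann hT ω o ((α : T ≃g T) o) ∧
      ∀ k, (α : T ≃g T) ((rayTo hT o ω).vert (m + k)) = (rayTo hT o ω).vert (n + k) := by
  have h := rayTo_equivalent hT ω ((α : T ≃g T) o) o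
  obtain ⟨m, n, -, e⟩ := h.exists_eq 0
  refine ⟨m, n, (busemann_eq hT ω e).symm, fun k => ?_⟩
  rw [← rayTo_map hT α.2, h.eq_add hT e]

lemma mem_Hor_iff_busemann (hT : T.IsTree) (ω : TreeEnd hT) (o : V) (α : Aff hT ω) :
    α ∈ Hor hT ω o ↔ busemann hT ω o ((α : T ≃g T) o) = 0 := by
  rw [Hor, MonoidHom.mem_ker]
  exact ofAdd_eq_one

lemma exists_fixes_of_mem_Hor (hT : T.IsTree) {ω : TreeEnd hT} {o : V} {α : Aff hT ω}
    (hα : α ∈ Hor hT ω o) :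
    ∃ m : ℕ, ∀ k, (α : T ≃g T) ((rayTo hT o ω).vert (m + k)) = (rayTo hT o ω).vert (m + k) := by
  obtain ⟨m, n, hmn, h⟩ := exists_shift hT o α
  rw [(mem_Hor_iff_busemann hT ω o α).mp hα, sub_eq_zero, Nat.cast_inj] at hmn
  subst hmn
  exact ⟨m, h⟩

/-- The difference `h(α v) - h(v)` does not depend on `v`, so one fixed vertex makes it zero
everywhere. -/
lemma mem_Hor_of_apply_eq_self (hT : T.IsTree) {ω : TreeEnd hT} (o : V) {α : Aff hT ω} {v : V}
    (hv : (α : T ≃g T) v = v) : α ∈ Hor hT ω o := by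
  have h₁ := busemann_add hT ω o ((α : T ≃g T) o) ((α : T ≃g T) v)
  rw [busemann_smul, hv] at h₁
  rw [mem_Hor_iff_busemann]
  omega

/-- For every end `ξ ≠ ω` there is a vertex between `ω` and `ξ`; it is fixed by each horocyclic
automorphism that fixes `ξ`. -/
lemma exists_vertex_fixed_of_mem_Hor (hT : T.IsTree) {ω ξ : TreeEnd hT} (hξ : ξ ≠ ω) (o : V) :
    ∃ v, ∀ α : Aff hT ω, α ∈ Hor hT ω o → (α : T ≃g T) • ξ = ξ → (α : T ≃g T) v = v := by
  set x := rayTo hT o ω with hx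
  set y := rayTo hT o ξ with hy
  obtain ⟨M, hM, hM'⟩ : ∃ M, x.vert M = y.vert M ∧ x.vert (M + 1) ≠ y.vert (M + 1) := by
    by_contra! hc
    have hxy : ∀ k, x.vert k = y.vert k := fun k => by
      induction k with
      | zero => rw [hx, hy, rayTo_zero, rayTo_zero]
      | succ k ih => exact hc k ih
    apply hξ
    rw [← rayTo_toEnd hT o ω, ← rayTo_toEnd hT o ξ, GeodesicRay.toEnd_eq]
    exact GeodesicRay.equivalent_of_eq_add hT (m := 0) (n := 0) fun k => (hxy _).symm
  -- The ray `z` runs back from `x (M + k)` to the branching vertex `x M = y M`, then along `y`. The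
  -- condition on `z 1` lets the next vertex be prepended without backtracking.
  have key : ∀ k, ∃ z : GeodesicRay T, z.vert 0 = x.vert (M + k) ∧
      z.vert 1 ≠ x.vert (M + k + 1) ∧ ∀ j, z.vert (k + j) = y.vert (M + j) := fun k => by
    induction k with
    | zero =>
      refine ⟨⟨fun j => y.vert (M + j), fun n => y.adj _, fun n => y.no_backtrack _⟩,
        hM.symm, hM'.symm, fun j => by simp⟩
    | succ k ih =>
      obtain ⟨z, h₀, h₁, h₂⟩ := ih
      refine ⟨z.cons (x.vert (M + k + 1)) (h₀ ▸ (x.adj (M + k)).symm) h₁.symm, rfl, ?_,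
        fun j => ?_⟩
      · exact fun h => x.no_backtrack (M + k) (h₀.symm.trans h)
      · rw [← h₂ j, show k + 1 + j = (k + j) + 1 by omega]
        rfl
  refine ⟨y.vert M, fun α hα hαξ => ?_⟩
  -- For large `m`, `α` fixes the start of `z` and its end `ξ`, hence all of `z`, which passes
  -- through `y M`.
  obtain ⟨m, hm⟩ := exists_fixes_of_mem_Hor hT hα
  obtain ⟨z, h₀, -, h₂⟩ := key m
  have hz : z.toEnd hT = ξ := by
    rw [← rayTo_toEnd hT o ξ, GeodesicRay.toEnd_eq]
    exact GeodesicRay.equivalent_of_eq_add hT h₂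
  have := GeodesicRay.map_vert_eq hT (x := z) (α := (α : T ≃g T)) (by rw [hz, hαξ]) (i := 0)
    (by rw [h₀, add_comm M m, hm]) m
  rwa [zero_add, ← add_zero m, h₂] at this

/-! ### The two implications -/

lemma isUnimodular_of_isExceptional [T.LocallyFinite] (hT : T.IsTree) {ω : TreeEnd hT} {o : V}
    {Γ : Subgroup (Aff hT ω)} (hΓ : IsClosed (Γ : Set (Aff hT ω)))
    (h : IsExceptional hT ω o Γ) : IsUnimodular Γ := by
  apply isUnimodular_of_forall_exists_mul_mem_iff
  intro g
  suffices H : ∃ v : V, ∀ x : Γ, x * g ∈ MulAction.stabilizer Γ v ↔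
      g * x ∈ MulAction.stabilizer Γ v by
    obtain ⟨v, hv⟩ := H
    exact ⟨MulAction.stabilizer Γ v, (isClopen_stabilizer hT Γ v).isOpen,
      isCompact_stabilizer hT hΓ v, ⟨1, one_mem _⟩, hv⟩
  rcases h with h | ⟨ξ, hξ, h⟩
  · obtain ⟨m, hm⟩ := exists_fixes_of_mem_Hor hT (h g.2)
    refine ⟨(rayTo hT o ω).vert (m + 0), fun x => ?_⟩
    have hg : g ∈ MulAction.stabilizer Γ ((rayTo hT o ω).vert (m + 0)) := hm 0
    rw [Subgroup.mul_mem_cancel_right _ hg, Subgroup.mul_mem_cancel_left _ hg]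
  · obtain ⟨v, hv⟩ := exists_vertex_fixed_of_mem_Hor hT hξ o
    have key : ∀ x : Γ, x ∈ MulAction.stabilizer Γ v ↔ (x : Aff hT ω) ∈ Hor hT ω o := fun x =>
      ⟨fun hx => mem_Hor_of_apply_eq_self hT o hx, fun hx => hv x hx (h x x.2)⟩
    refine ⟨v, fun x => ?_⟩
    rw [key, key, Hor, MonoidHom.mem_ker, MonoidHom.mem_ker, Subgroup.coe_mul, Subgroup.coe_mul,
      map_mul, map_mul, mul_comm]

lemma pow_apply_of_shift {x : ℕ → V} {γ : T ≃g T} {p : ℕ} (h : ∀ k, γ (x k) = x (k + p))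
    (i k : ℕ) : (γ ^ i) (x k) = x (k + i * p) := by
  induction i with
  | zero => simp
  | succ i ih =>
    rw [pow_succ', RelIso.mul_apply, ih, h]
    congr 1
    ring

/-- The other end of the axis of an automorphism that shifts a ray. -/
lemma exists_ray_of_shift (hT : T.IsTree) {x : GeodesicRay T} {γ : T ≃g T} {q : ℕ}
    (h : ∀ k, γ (x.vert k) = x.vert (k + (q + 1))) :
    ∃ y : GeodesicRay T, (∀ i, (γ ^ i) (y.vert i) = x.vert (i * q)) ∧
      γ • y.toEnd hT = y.toEnd hT ∧ y.toEnd hT ≠ x.toEnd hT := by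
  have hpow := pow_apply_of_shift h
  -- Since `γ` shifts by `q + 1`, this is the axis vertex at position `i * q - i * (q + 1) = -i`.
  let f : ℕ → V := fun i => (γ ^ i)⁻¹ (x.vert (i * q))
  have hf : ∀ i j, (γ ^ (i + j)) (f i) = x.vert (i * q + j * (q + 1)) := fun i j => by
    rw [add_comm i j, pow_add, RelIso.mul_apply, RelIso.apply_inv_self, hpow]
  have hf₀ : ∀ i, (γ ^ i) (f i) = x.vert (i * q) := fun i => RelIso.apply_inv_self _ _
  let y : GeodesicRay T :=
    { vert := f
      adj := fun i => by
        rw [← (γ ^ (i + 1)).map_adj_iff, hf i 1, hf₀]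
        convert! (x.adj (i * q + q)).symm using 2 <;> ring
      no_backtrack := fun i e => by
        have e' := congrArg (γ ^ (i + 2)) e
        rw [hf i 2, hf₀] at e'
        have := x.injective hT e'
        grind }
  refine ⟨y, hf₀, ?_, fun e => ?_⟩
  · rw [smul_toEnd, GeodesicRay.toEnd_eq]
    refine GeodesicRay.equivalent_of_eq_add hT (m := q + 1) (n := 0) fun k => ?_
    change γ (f (q + 1 + k)) = f (0 + k)
    apply (γ ^ (k + q)).injective
    rw [← RelIso.mul_apply, ← pow_succ, zero_add, hf k q,
      show k + q + 1 = q + 1 + k by ring, hf₀]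
    congr 1
    ring
  · rw [GeodesicRay.toEnd_eq] at e
    have h0 : y.vert 0 = x.vert 0 := by simpa using hf₀ 0
    have h1 : f 1 = x.vert 1 := by simpa using e.eq_add hT h0 1
    have h2 := hf₀ 1
    rw [h1, pow_one, h] at h2
    have := x.injective hT h2
    omega

lemma exists_fixed_end_of_isUnimodular [T.LocallyFinite] (hT : T.IsTree) {ω : TreeEnd hT} {o : V}
    {Γ : Subgroup (Aff hT ω)} (hΓ : IsClosed (Γ : Set (Aff hT ω))) (h : IsUnimodular Γ) (γ : Γ)
    (hγ : busemann hT ω o (((γ : Aff hT ω) : T ≃g T) o) < 0) :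
    ∃ ξ : TreeEnd hT, ξ ≠ ω ∧ γ • ξ = ξ ∧ ∀ δ : Γ, (δ : Aff hT ω) ∈ Hor hT ω o → δ • ξ = ξ := by
  obtain ⟨m, n, hmn, hs⟩ := exists_shift hT o (γ : Aff hT ω)
  -- A negative value of `φ` means a strictly positive shift towards `ω`.
  obtain ⟨q, rfl⟩ : ∃ q, n = m + (q + 1) := ⟨n - m - 1, by omega⟩
  let x : GeodesicRay T :=
    { vert := fun k => (rayTo hT o ω).vert (m + k)
      adj := fun k => (rayTo hT o ω).adj _
      no_backtrack := fun k => (rayTo hT o ω).no_backtrack _ }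
  have hx : x.toEnd hT = ω := by
    rw [← rayTo_toEnd hT o ω, GeodesicRay.toEnd_eq]
    exact GeodesicRay.equivalent_of_eq_add hT (m := 0) (n := m) fun k => by
      rw [zero_add]
  have hshift : ∀ k, γ • x.vert k = x.vert (k + (q + 1)) := fun k => by
    rw [show x.vert (k + (q + 1)) = (rayTo hT o ω).vert (m + (q + 1) + k) from
      congrArg (rayTo hT o ω).vert (by ring)]
    exact hs k
  have hpow : ∀ i k, γ ^ i • x.vert k = x.vert (k + i * (q + 1)) := pow_apply_of_shift hshift
  set K := MulAction.stabilizer Γ (x.vert 0) with hK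
  have hKx : ∀ δ ∈ K, ∀ k, δ • x.vert k = x.vert k := fun δ hδ k => by
    have := GeodesicRay.map_vert_eq hT (x := x) (α := ((δ : Aff hT ω) : T ≃g T))
      (by rw [hx]; exact (δ : Aff hT ω).2) (i := 0) hδ k
    rwa [zero_add] at this
  have hconj : ∀ δ ∈ K, ∀ i, (γ ^ i)⁻¹ * δ * γ ^ i ∈ K := fun δ hδ i => by
    rw [hK, MulAction.mem_stabilizer_iff, mul_smul, mul_smul, inv_smul_eq_iff, hpow, hKx δ hδ]
  have hconj' : ∀ i (δ : Γ), (γ ^ i)⁻¹ * δ * γ ^ i ∈ K → δ ∈ K := fun i δ hδ =>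
    h.eq_of_subset_conj (isClopen_stabilizer hT Γ _) (isCompact_stabilizer hT hΓ _) (γ ^ i)
      (fun δ' hδ' => hconj δ' hδ' i) hδ
  obtain ⟨y, hy, hγy, hyx⟩ := exists_ray_of_shift hT (γ := ((γ : Aff hT ω) : T ≃g T)) hshift
  refine ⟨y.toEnd hT, hx ▸ hyx, hγy, fun δ hδ => ?_⟩
  have hδK : δ ∈ K := by
    -- The conjugate by `γ ^ M` fixes `x 0` because `δ` fixes `x (M * (q + 1))`, which lies beyond
    -- index `M` of the ray from `o`.
    obtain ⟨M, hM⟩ := exists_fixes_of_mem_Hor hT hδ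
    apply hconj' M
    rw [hK, MulAction.mem_stabilizer_iff, mul_smul, mul_smul, inv_smul_eq_iff, hpow]
    have := hM (m + M * q)
    rwa [show M + (m + M * q) = m + (0 + M * (q + 1)) by ring] at this
  refine smul_toEnd_eq_of_fixes hT (x := y) (i := 0) fun k => ?_
  rw [zero_add]
  change δ • y.vert k = y.vert k
  have hy' : γ ^ k • y.vert k = x.vert (k * q) := hy k
  -- As `γ ^ k` carries `y k` into the ray `x`, it suffices that this conjugate of `δ` fixes `x`.
  have hmem : γ ^ k * δ * (γ ^ k)⁻¹ ∈ K := hconj' k _ (by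
    rwa [show (γ ^ k)⁻¹ * (γ ^ k * δ * (γ ^ k)⁻¹) * γ ^ k = δ by group])
  have := hKx _ hmem (k * q)
  rwa [← hy', mul_smul, mul_smul, inv_smul_smul, smul_left_cancel_iff] at this

lemma isExceptional_of_isUnimodular [T.LocallyFinite] (hT : T.IsTree) {ω : TreeEnd hT} {o : V}
    {Γ : Subgroup (Aff hT ω)} (hΓ : IsClosed (Γ : Set (Aff hT ω))) (h : IsUnimodular Γ) :
    IsExceptional hT ω o Γ := by
  let φ : Γ →* Multiplicative ℤ := (horocyclic hT ω o).comp Γ.subtype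
  have hφ : ∀ δ : Γ, (δ : Aff hT ω) ∈ Hor hT ω o ↔ φ δ = 1 := fun δ => MonoidHom.mem_ker
  obtain ⟨⟨_, γ, rfl⟩, hγ⟩ := (inferInstance : IsCyclic φ.range).exists_generator
  have hgen : ∀ δ : Γ, ∃ k : ℤ, φ (γ ^ k) = φ δ := fun δ => by
    obtain ⟨k, hk⟩ := Subgroup.mem_zpowers_iff.mp (hγ ⟨φ δ, δ, rfl⟩)
    exact ⟨k, by rw [map_zpow]; exact congrArg Subtype.val hk⟩
  suffices H : (∃ ξ : TreeEnd hT, ξ ≠ ω ∧ γ • ξ = ξ ∧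
      ∀ δ : Γ, (δ : Aff hT ω) ∈ Hor hT ω o → δ • ξ = ξ) ∨ φ γ = 1 by
    rcases H with ⟨ξ, hξ, hγξ, hH⟩ | H
    · refine Or.inr ⟨ξ, hξ, fun δ hδ => ?_⟩
      obtain ⟨k, hk⟩ := hgen ⟨δ, hδ⟩
      -- Dividing `δ` by a power of `γ` with the same value of `φ` leaves a horocyclic element.
      have h₁ := hH ((γ ^ k)⁻¹ * ⟨δ, hδ⟩) ((hφ _).mpr (by
        rw [map_mul, map_inv, hk, inv_mul_cancel]))
      have h₂ : γ ^ k ∈ MulAction.stabilizer Γ ξ := zpow_mem (K := MulAction.stabilizer Γ ξ) hγξ k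
      rw [mul_smul, inv_smul_eq_iff, h₂] at h₁
      exact h₁
    · refine Or.inl fun δ hδ => (hφ ⟨δ, hδ⟩).mpr ?_
      obtain ⟨k, hk⟩ := hgen ⟨δ, hδ⟩
      rw [← hk, map_zpow, H, one_zpow]
  rcases lt_trichotomy (busemann hT ω o (((γ : Aff hT ω) : T ≃g T) o)) 0 with hlt | heq | hgt
  · exact Or.inl (exists_fixed_end_of_isUnimodular hT hΓ h γ hlt)
  · exact Or.inr ((hφ γ).mp ((mem_Hor_iff_busemann hT ω o γ).mpr heq))
  · have hinv : φ γ⁻¹ = (φ γ)⁻¹ := map_inv φ γ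
    have hneg : busemann hT ω o ((((γ⁻¹ : Γ) : Aff hT ω) : T ≃g T) o) =
        -busemann hT ω o (((γ : Aff hT ω) : T ≃g T) o) := hinv
    obtain ⟨ξ, hξ, hγξ, hH⟩ := exists_fixed_end_of_isUnimodular (o := o) hT hΓ h γ⁻¹ (by
      rw [hneg]; omega)
    exact Or.inl ⟨ξ, hξ, (inv_smul_eq_iff.mp hγξ).symm, hH⟩

end Tree

end HomTree

theorem mainTheorem7 {V : Type*} (T : SimpleGraph V) [T.LocallyFinite] (hT : T.IsTree)
    (d : ℕ) (hd : 3 ≤ d) (hreg : T.IsRegularOfDegree d)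
    (ω : HomTree.TreeEnd hT) (o : V)
    (Γ : Subgroup (HomTree.Aff hT ω)) (hΓ : IsClosed (Γ : Set (HomTree.Aff hT ω))) :
    HomTree.IsUnimodular Γ ↔ HomTree.IsExceptional hT ω o Γ := by
  exact ⟨HomTree.isExceptional_of_isUnimodular hT hΓ,
    HomTree.isUnimodular_of_isExceptional hT hΓ⟩
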